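/- Let $k$ be a field. For a finite set of variables $\mathbf t$ let $k[\mathbf t^{\pm1}]$ be the Laurent polynomial ring. A parametrization of an ideal $I$ of a polynomial ring $k[\mathbf x]$ in finitely many variables is a $k$-algebra morphism $\varphi:k[\mathbf x]\to k[\mathbf t^{\pm1}]$ that sends each variable to a Laurent monomial $\mathbf t^{\alpha}$ and satisfies $\operatorname{Ker}\varphi=I$; an ideal that has a parametrization is called toric. The parametrization has maximal rank if the Krull dimension $\dim(k[\mathbf x]/I)$ equals the number of variables in $\mathbf t$. It is called minimal if the monomials $\varphi(x)$, for $x$ in $\mathbf x$, form a minimal system of generators of the $k$-algebra they generate, that is, none of them lies in the subalgebra generated by the others. An ideal is called homogeneous if it is homogeneous for the standard grading of the polynomial ring. Let $\mathbf z_1,\dots,\mathbf z_r$ be pairwise disjoint finite sets of variables, and for $i=1,\dots,r$ let $I_i\subset k[\mathbf z_i]$ be a homogeneous toric ideal with a parametrization $\varphi_i:k[\mathbf z_i]\to k[\mathbf t_i^{\pm1}]$ of maximal rank, where $\mathbf t_1,\dots,\mathbf t_r$ are pairwise disjoint finite sets of variables. Let $\sum_{i=1}^r I_i$ denote the ideal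 of $k[\mathbf z_1,\dots,\mathbf z_r]$ generated by $I_1,\dots,I_r$, and let $$\varphi:k[\mathbf z_1,\dots,\mathbf z_r]\to k[\mathbf t_1^{\pm1},\dots,\mathbf t_r^{\pm1}]$$ be the $k$-algebra morphism with $\varphi(z)=\varphi_i(z)$ for every variable $z$ in $\mathbf z_i$, $i=1,\dots,r$. Then $\sum_{i=1}^r I_i$ is a homogeneous toric ideal, and $\varphi$ is a parametrization of it of maximal rank. If every $\varphi_i$ is minimal, then so is $\varphi$. Moreover $$\dim\Bigl(k[\mathbf z_1,\dots,\mathbf z_r]\Big/\sum_{i=1}^r I_i\Bigr)=\sum_{i=1}^r\dim\bigl(k[\mathbf z_i]/I_i\bigr).$$ -/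

import Mathlib

open MvPolynomial

noncomputable section

/-- The Laurent polynomial ring `k[t^{±1}]` in the variables `t = (t_j)_{j : τ}`: the group algebra
of the free abelian group of exponent vectors. -/
abbrev LaurentRing (k : Type*) [Field k] (τ : Type*) : Type _ := AddMonoidAlgebra k (τ →₀ ℤ)

/-- The Laurent monomial `t^α`. -/
def laurentMonomial (k : Type*) [Field k] {τ : Type*} (α : τ →₀ ℤ) : LaurentRing k τ :=
  AddMonoidAlgebra.single α 1

/-- The morphism `k[t^{±1}] → k[u^{±1}]` that renames the variables along `f`, so that
`t^α` goes to `u^{f_* α}`. For injective `f` it is the inclusion of Laurent rings. -/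
def laurentRename (k : Type*) [Field k] {τ τ' : Type*} (f : τ → τ') :
    LaurentRing k τ →ₐ[k] LaurentRing k τ' :=
  AddMonoidAlgebra.mapDomainAlgHom k k (Finsupp.mapDomain.addMonoidHom f : (τ →₀ ℤ) →+ (τ' →₀ ℤ))

theorem laurentRename_monomial (k : Type*) [Field k] {τ τ' : Type*} (f : τ → τ') (α : τ →₀ ℤ) :
    laurentRename k f (laurentMonomial k α) = laurentMonomial k (α.mapDomain f) := by
  simp [laurentRename, laurentMonomial]

/-- `φ : k[x] → k[t^{±1}]` is a parametrization of the ideal `I`: it is a morphism of `k`-algebras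
that sends every variable to a Laurent monomial, and `I` is its kernel. -/
structure IsParametrization {k : Type*} [Field k] {σ τ : Type*}
    (φ : MvPolynomial σ k →ₐ[k] LaurentRing k τ) (I : Ideal (MvPolynomial σ k)) : Prop where
  exists_monomial : ∀ a : σ, ∃ α : τ →₀ ℤ, φ (X a) = laurentMonomial k α
  ker_eq : RingHom.ker φ = I

/-- A toric ideal: the kernel of a monomial map into a Laurent ring in finitely many variables. -/
def IsToricIdeal {k : Type*} [Field k] {σ : Type*} (I : Ideal (MvPolynomial σ k)) : Prop :=
  ∃ (m : ℕ) (φ : MvPolynomial σ k →ₐ[k] LaurentRing k (Fin m)), IsParametrization φ I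

attribute [local instance] MvPolynomial.gradedAlgebra

/-- A homogeneous toric ideal, for the standard grading of the polynomial ring. -/
def IsHomogeneousToricIdeal {k : Type*} [Field k] {σ : Type*}
    (I : Ideal (MvPolynomial σ k)) : Prop :=
  IsToricIdeal I ∧ I.IsHomogeneous (homogeneousSubmodule σ k)

/-- A parametrization `φ` of `I` of maximal rank: the Krull dimension of `k[x]/I` is the number of
the variables `t`. -/
structure IsMaximalRankParametrization {k : Type*} [Field k] {σ τ : Type*}
    (φ : MvPolynomial σ k →ₐ[k] LaurentRing k τ) (I : Ideal (MvPolynomial σ k)) : Prop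
    extends IsParametrization φ I where
  dim_eq : ringKrullDim (MvPolynomial σ k ⧸ I) = (Nat.card τ : WithBot ℕ∞)

/-- The family `(φ(x_a))_a` is a minimal system of generators of the algebra that it generates:
none of its members lies in the subalgebra generated by the others. -/
def HasMinimalGenerators {k : Type*} [Field k] {σ τ : Type*}
    (φ : MvPolynomial σ k →ₐ[k] LaurentRing k τ) : Prop :=
  ∀ a : σ, φ (X a) ∉ Algebra.adjoin k ((fun b : σ => φ (X b)) '' {a}ᶜ)

/-- The sum `∑ I_i` in the polynomial ring in the disjoint union of the variable sets `z_i`, each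
`I_i` being extended along the inclusion `k[z_i] ⊆ k[z_1, …, z_r]`. -/
def sumIdeal {k : Type*} [Field k] {r : ℕ} {σ : Fin r → Type*}
    (I : ∀ i, Ideal (MvPolynomial (σ i) k)) : Ideal (MvPolynomial (Σ i, σ i) k) :=
  ∑ i, (I i).map (rename (Sigma.mk i) : MvPolynomial (σ i) k →ₐ[k] MvPolynomial (Σ i, σ i) k)

/-- The morphism `φ : k[z_1, …, z_r] → k[t_1^{±1}, …, t_r^{±1}]` with
`φ(z_{i,j}) = φ_i(z_{i,j})`, where `k[t_i^{±1}] ⊆ k[t_1^{±1}, …, t_r^{±1}]`. -/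
def combinedMap {k : Type*} [Field k] {r : ℕ} {σ τ : Fin r → Type*}
    (φ : ∀ i, MvPolynomial (σ i) k →ₐ[k] LaurentRing k (τ i)) :
    MvPolynomial (Σ i, σ i) k →ₐ[k] LaurentRing k (Σ i, τ i) :=
  aeval fun p : Σ i, σ i => laurentRename k (Sigma.mk p.1) (φ p.1 (X p.2))

end

/-! The kernel of a monomial map is spanned by the binomials `x^u - x^v` whose two terms have equal
image (`ker_le_of_binomials_mem`). The blocks use disjoint variables `t_i`, so setting the other
blocks to `1` (`laurentRetract`) splits one such equality into an equality for each `φ_i`. Hence the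
two monomials agree block by block modulo `I_i`, and so do their products: this gives the kernel.
The same retraction carries minimality.

By Noether normalization the dimension of an affine domain is its transcendence degree. Maximal rank
therefore means that the Laurent ring is algebraic over the image
(`ringKrullDim_quotient_ker_eq_card_iff`). That condition needs checking only on the variables `t`,
one block at a time. The dimension formula then counts variables. -/

/-! ### Krull dimension and transcendence degree -/

section KrullDimension

/-- Krull dimension is invariant under injective integral ring extensions. -/
theorem ringKrullDim_eq_of_isIntegral (R S : Type*) [CommRing R] [CommRing S] [Algebra R S]
    [Algebra.IsIntegral R S] [FaithfulSMul R S] : ringKrullDim S = ringKrullDim R := by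
  apply le_antisymm
  -- Incomparability makes contraction of primes strictly monotone.
  · refine Order.krullDim_le_of_strictMono (PrimeSpectrum.comap (algebraMap R S)) fun P Q h => ?_
    exact Ideal.IsIntegral.comap_lt_comap (R := R) (I := P.asIdeal) (J := Q.asIdeal) h
  -- Lying over lifts the smallest prime of a chain; going up lifts the rest.
  · refine iSup_le fun l => ?_
    obtain ⟨P, hP, hPl⟩ :=
      (inferInstance : Nonempty (Ideal.primesOver l.head.asIdeal S))
    obtain ⟨L, hL, -⟩ := Ideal.exists_ltSeries_of_hasGoingUp (S := S) l P
    rw [← hL]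
    exact Order.LTSeries.length_le_krullDim L

/-- The Krull dimension of an affine domain is its transcendence degree. -/
theorem ringKrullDim_eq_toNat_trdeg (k A : Type*) [Field k] [CommRing A] [IsDomain A]
    [Algebra k A] [Algebra.FiniteType k A] :
    ringKrullDim A = (Cardinal.toNat (Algebra.trdeg k A) : WithBot ℕ∞) := by
  -- Noether normalization: `A` is integral over a polynomial ring in `s` variables, so both sides
  -- equal `s`.
  obtain ⟨s, g, hg, hint⟩ := exists_integral_inj_algHom_of_fg k A
  let _ : Algebra (MvPolynomial (Fin s) k) A := g.toRingHom.toAlgebra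
  have : IsScalarTower k (MvPolynomial (Fin s) k) A :=
    .of_algebraMap_eq fun x => (g.commutes x).symm
  have : Algebra.IsIntegral (MvPolynomial (Fin s) k) A := ⟨hint⟩
  have : FaithfulSMul (MvPolynomial (Fin s) k) A :=
    (faithfulSMul_iff_algebraMap_injective _ _).mpr hg
  have h := lift_trdeg_add_eq k (MvPolynomial (Fin s) k) A
  rw [trdeg_eq_zero (R := MvPolynomial (Fin s) k) (A := A)] at h
  have h' := congrArg Cardinal.toNat h
  simp at h'
  rw [ringKrullDim_eq_of_isIntegral (MvPolynomial (Fin s) k) A,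
    MvPolynomial.ringKrullDim_of_isNoetherianRing, ringKrullDim_eq_zero_of_field, ← h']
  simp

end KrullDimension

/-! ### Laurent rings and algebraicity over subalgebras -/

section Laurent

variable {k : Type*} [Field k] {σ τ τ' : Type*}

theorem laurentMonomial_zero : laurentMonomial k (0 : τ →₀ ℤ) = 1 := rfl

theorem laurentMonomial_add (α β : τ →₀ ℤ) :
    laurentMonomial k (α + β) = laurentMonomial k α * laurentMonomial k β := by
  simp [laurentMonomial, AddMonoidAlgebra.single_mul_single]

theorem laurentMonomial_nsmul (n : ℕ) (α : τ →₀ ℤ) :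
    laurentMonomial k (n • α) = laurentMonomial k α ^ n := by
  simp [laurentMonomial, AddMonoidAlgebra.single_pow]

theorem laurentRename_injective {f : τ → τ'} (hf : Function.Injective f) :
    Function.Injective (laurentRename k f) :=
  AddMonoidAlgebra.mapDomain_injective (Finsupp.mapDomain_injective hf)

/-- A subspace containing all monomials is the whole Laurent ring. -/
theorem laurent_mem_of_forall_monomial_mem {V : Submodule k (LaurentRing k τ)}
    (h : ∀ α, laurentMonomial k α ∈ V) (x : LaurentRing k τ) : x ∈ V := by
  induction x using AddMonoidAlgebra.induction_on with
  | of m => exact h m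
  | add x y hx hy => exact V.add_mem hx hy
  | smul r x hx => exact V.smul_mem r hx

/-- Algebraic elements are closed under sums and products. Negative powers are covered because a
factor of the algebraic element `1` is algebraic once the nonzero cofactor is. -/
theorem laurent_isAlgebraic_of_forall_variable (S : Subalgebra k (LaurentRing k τ))
    (h : ∀ j : τ, IsAlgebraic S (laurentMonomial k (Finsupp.single j 1))) :
    Algebra.IsAlgebraic S (LaurentRing k τ) := by
  have key : ∀ α : τ →₀ ℤ, IsAlgebraic S (laurentMonomial k α) := by
    intro α
    induction α using Finsupp.induction_linear with
    | zero => rw [laurentMonomial_zero]; exact isAlgebraic_one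
    | add α β hα hβ => rw [laurentMonomial_add]; exact hα.mul hβ
    | single j n =>
      have hpow (m : ℕ) : IsAlgebraic S (laurentMonomial k (Finsupp.single j (m : ℤ))) := by
        have : Finsupp.single j (m : ℤ) = m • Finsupp.single j (1 : ℤ) := by simp
        rw [this, laurentMonomial_nsmul]
        exact (h j).pow m
      obtain ⟨m, rfl | rfl⟩ := n.eq_nat_or_neg
      · exact hpow m
      · have hmul : laurentMonomial k (Finsupp.single j (m : ℤ)) *
            laurentMonomial k (Finsupp.single j (-(m : ℤ))) = 1 := by
          rw [← laurentMonomial_add, ← Finsupp.single_add]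
          simp [laurentMonomial_zero]
        refine IsAlgebraic.of_mul (y := laurentMonomial k (Finsupp.single j (m : ℤ))) ?_
          (hpow m) (hmul ▸ isAlgebraic_one)
        exact mem_nonZeroDivisors_of_ne_zero (left_ne_zero_of_mul_eq_one hmul)
  refine ⟨fun x => ?_⟩
  exact laurent_mem_of_forall_monomial_mem
    (V := ((Subalgebra.algebraicClosure S (LaurentRing k τ)).restrictScalars k).toSubmodule) key x

/-- Evaluation at the variables is induced by the injection of exponents from `ℕ` to `ℤ`. -/
theorem algebraicIndependent_laurent_variables :
    AlgebraicIndependent k fun j : τ => laurentMonomial k (Finsupp.single j 1) := by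
  let f : MvPolynomial τ k →ₐ[k] LaurentRing k τ :=
    AddMonoidAlgebra.mapDomainAlgHom k k
      (Finsupp.mapRange.addMonoidHom (Nat.castAddMonoidHom ℤ) : (τ →₀ ℕ) →+ (τ →₀ ℤ))
  have hf : Function.Injective f := AddMonoidAlgebra.mapDomain_injective
    (Finsupp.mapRange_injective _ (by simp) Nat.cast_injective)
  have : aeval (fun j : τ => laurentMonomial k (Finsupp.single j 1)) = f := by
    ext j : 1
    rw [aeval_X]
    change _ = AddMonoidAlgebra.mapDomain _ (AddMonoidAlgebra.single _ _)
    rw [AddMonoidAlgebra.mapDomain_single]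
    simp [laurentMonomial]
  rw [AlgebraicIndependent, this]
  exact hf

/-- The variables form a transcendence basis. Finiteness is recorded because `Cardinal.toNat` sends
infinite cardinals to `0`. -/
theorem toNat_trdeg_laurent [Finite τ] :
    Algebra.trdeg k (LaurentRing k τ) < Cardinal.aleph0 ∧
    Cardinal.toNat (Algebra.trdeg k (LaurentRing k τ)) = Nat.card τ := by
  have hb : IsTranscendenceBasis k fun j : τ => laurentMonomial k (Finsupp.single j 1) := by
    rw [algebraicIndependent_laurent_variables.isTranscendenceBasis_iff_isAlgebraic]
    refine laurent_isAlgebraic_of_forall_variable _ fun j => ?_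
    exact isAlgebraic_algebraMap (A := LaurentRing k τ) (⟨laurentMonomial k (Finsupp.single j 1),
      Algebra.subset_adjoin ⟨j, rfl⟩⟩ : Algebra.adjoin k
        (Set.range fun j : τ => laurentMonomial k (Finsupp.single j 1)))
  have h := hb.lift_cardinalMk_eq_trdeg
  constructor
  · rw [← Cardinal.lift_lt_aleph0, ← h, Cardinal.lift_lt_aleph0]
    exact Cardinal.mk_lt_aleph0
  · have := congrArg Cardinal.toNat h
    simpa [Nat.card] using this.symm

/-- The affine algebra presented by `φ` has the dimension of the torus exactly when the Laurent
ring is algebraic over the image of `φ`. -/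
theorem ringKrullDim_quotient_ker_eq_card_iff [Finite σ] [Finite τ]
    (φ : MvPolynomial σ k →ₐ[k] LaurentRing k τ) :
    ringKrullDim (MvPolynomial σ k ⧸ RingHom.ker φ) = (Nat.card τ : WithBot ℕ∞) ↔
      Algebra.IsAlgebraic φ.range (LaurentRing k τ) := by
  have : Algebra.FiniteType k φ.range :=
    .of_surjective φ.rangeRestrict φ.rangeRestrict_surjective
  rw [ringKrullDim_eq_of_ringEquiv (Ideal.quotientKerEquivRange φ).toRingEquiv,
    ringKrullDim_eq_toNat_trdeg k φ.range]
  obtain ⟨hfin, hcard⟩ := toNat_trdeg_laurent (k := k) (τ := τ)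
  -- Additivity in the tower from `k` through the image to the Laurent ring: the dimension is full
  -- exactly when the upper degree vanishes.
  have hadd := trdeg_add_eq k φ.range (A := LaurentRing k τ)
  rw [← hadd] at hfin hcard
  obtain ⟨h₁, h₂⟩ := Cardinal.add_lt_aleph0_iff.mp hfin
  rw [Cardinal.toNat_add h₁ h₂] at hcard
  rw [← trdeg_eq_zero_iff, ← hcard]
  have h0 : Algebra.trdeg φ.range (LaurentRing k τ) = 0 ↔
      Cardinal.toNat (Algebra.trdeg φ.range (LaurentRing k τ)) = 0 := by
    rw [Cardinal.toNat_eq_zero]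
    simp [h₂.not_ge]
  rw [h0]
  norm_cast
  omega

end Laurent

/-! ### Kernels of monomial maps -/

section MonomialMaps

variable {k : Type*} [Field k] {σ τ : Type*}

/-- A monomial map sends monomials to Laurent monomials. -/
theorem exists_map_monomial_eq_laurentMonomial {φ : MvPolynomial σ k →ₐ[k] LaurentRing k τ}
    (h : ∀ a : σ, ∃ α : τ →₀ ℤ, φ (X a) = laurentMonomial k α) (u : σ →₀ ℕ) :
    ∃ α : τ →₀ ℤ, φ (monomial u 1) = laurentMonomial k α := by
  induction u using Finsupp.induction_linear with
  | zero => exact ⟨0, by rw [laurentMonomial_zero]; exact map_one φ⟩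
  | add u v hu hv =>
    obtain ⟨α, hα⟩ := hu
    obtain ⟨β, hβ⟩ := hv
    refine ⟨α + β, ?_⟩
    rw [laurentMonomial_add, ← hα, ← hβ, ← map_mul, monomial_mul, one_mul]
  | single a n =>
    obtain ⟨α, hα⟩ := h a
    exact ⟨n • α, by rw [laurentMonomial_nsmul, ← hα, ← map_pow, X_pow_eq_monomial]⟩

/-- An ideal containing the binomials in the kernel of a monomial map contains the kernel. -/
theorem ker_le_of_binomials_mem {φ : MvPolynomial σ k →ₐ[k] LaurentRing k τ}
    (h : ∀ a : σ, ∃ α : τ →₀ ℤ, φ (X a) = laurentMonomial k α) (J : Ideal (MvPolynomial σ k))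
    (hJ : ∀ u v : σ →₀ ℕ, φ (monomial u 1) = φ (monomial v 1) →
      monomial u (1 : k) - monomial v 1 ∈ J) :
    RingHom.ker φ ≤ J := by
  classical
  -- The quotient map modulo `J` is factored linearly through `φ`. Each Laurent monomial in the
  -- image goes to the class of a chosen preimage, which by `hJ` does not depend on the choice; the
  -- value `0` elsewhere plays no role.
  let g : (τ →₀ ℤ) → MvPolynomial σ k ⧸ J := fun α =>
    if hα : ∃ u, φ (monomial u 1) = laurentMonomial k α then
      Ideal.Quotient.mk J (monomial hα.choose 1) else 0
  let L : LaurentRing k τ →ₗ[k] MvPolynomial σ k ⧸ J :=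
    Finsupp.linearCombination k g ∘ₗ (AddMonoidAlgebra.coeffLinearEquiv k).toLinearMap
  have hL : ∀ u, L (φ (monomial u 1)) = Ideal.Quotient.mk J (monomial u 1) := by
    intro u
    obtain ⟨α, hα⟩ := exists_map_monomial_eq_laurentMonomial h u
    have hex : ∃ u, φ (monomial u 1) = laurentMonomial k α := ⟨u, hα⟩
    have h1 : L (laurentMonomial k α) = g α := by
      simp [L, laurentMonomial, AddMonoidAlgebra.coeffLinearEquiv]
    rw [hα, h1]
    simp only [g, dif_pos hex]
    rw [Ideal.Quotient.mk_eq_mk_iff_sub_mem]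
    exact hJ _ _ (hex.choose_spec.trans hα.symm)
  have hcomp : ∀ p, L (φ p) = Ideal.Quotient.mk J p := by
    intro p
    induction p using MvPolynomial.induction_on' with
    | monomial u a =>
      have : monomial u a = a • monomial u (1 : k) := by simp [smul_monomial]
      rw [this, map_smul, map_smul, hL]
      rfl
    | add p q hp hq => rw [map_add, map_add, map_add, hp, hq]
  intro p hp
  rw [← Ideal.Quotient.eq_zero_iff_mem, ← hcomp, RingHom.mem_ker.mp hp, map_zero]

end MonomialMaps

/-! ### The combined parametrization -/

section Combined

variable {k : Type*} [Field k] {r : ℕ} {σ τ : Fin r → Type*}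

/-- The retraction of `k[t_1^{±1}, …, t_r^{±1}]` onto `k[t_i^{±1}]` that sets the variables of the
other blocks to `1`. -/
noncomputable def laurentRetract (k : Type*) [Field k] {r : ℕ} (τ : Fin r → Type*) (i : Fin r) :
    LaurentRing k (Σ i, τ i) →ₐ[k] LaurentRing k (τ i) :=
  AddMonoidAlgebra.mapDomainAlgHom k k
    (Finsupp.comapDomain.addMonoidHom (sigma_mk_injective (i := i)) :
      ((Σ i, τ i) →₀ ℤ) →+ (τ i →₀ ℤ))

theorem laurentRetract_monomial (i : Fin r) (α : (Σ i, τ i) →₀ ℤ) :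
    laurentRetract k τ i (laurentMonomial k α) =
      laurentMonomial k (α.comapDomain (Sigma.mk i) sigma_mk_injective.injOn) := by
  change AddMonoidAlgebra.mapDomain _ (AddMonoidAlgebra.single _ _) = _
  rw [AddMonoidAlgebra.mapDomain_single]
  rfl

theorem laurentRetract_laurentRename_self (i : Fin r) (x : LaurentRing k (τ i)) :
    laurentRetract k τ i (laurentRename k (Sigma.mk i) x) = x := by
  induction x using AddMonoidAlgebra.induction_on with
  | of m =>
    change laurentRetract k τ i (laurentRename k (Sigma.mk i) (laurentMonomial k m)) =
      laurentMonomial k m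
    rw [laurentRename_monomial, laurentRetract_monomial,
      Finsupp.comapDomain_mapDomain _ sigma_mk_injective]
  | add x y hx hy => simp only [map_add, hx, hy]
  | smul r x hx => simp only [map_smul, hx]

theorem laurentRetract_laurentRename_of_ne {i j : Fin r} (hij : j ≠ i) (α : τ j →₀ ℤ) :
    laurentRetract k τ i (laurentRename k (Sigma.mk j) (laurentMonomial k α)) = 1 := by
  rw [laurentRename_monomial, laurentRetract_monomial, ← laurentMonomial_zero]
  congr 1
  ext a
  rw [Finsupp.comapDomain_apply, Finsupp.mapDomain_of_notMem_range]
  · rfl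
  · rintro ⟨b, hb⟩
    exact hij (congrArg Sigma.fst hb)

theorem combinedMap_rename (φ : ∀ i, MvPolynomial (σ i) k →ₐ[k] LaurentRing k (τ i)) (i : Fin r)
    (p : MvPolynomial (σ i) k) :
    combinedMap φ (rename (Sigma.mk i) p) = laurentRename k (Sigma.mk i) (φ i p) := by
  have : (combinedMap φ).comp (rename (Sigma.mk i)) =
      (laurentRename k (Sigma.mk i)).comp (φ i) := by
    ext a : 1
    simp [combinedMap]
  exact DFunLike.congr_fun this p

theorem combinedMap_exists_monomial {φ : ∀ i, MvPolynomial (σ i) k →ₐ[k] LaurentRing k (τ i)}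
    (h : ∀ i a, ∃ α : τ i →₀ ℤ, φ i (X a) = laurentMonomial k α) (p : Σ i, σ i) :
    ∃ α : (Σ i, τ i) →₀ ℤ, combinedMap φ (X p) = laurentMonomial k α := by
  obtain ⟨α, hα⟩ := h p.1 p.2
  exact ⟨α.mapDomain (Sigma.mk p.1), by
    rw [combinedMap, aeval_X, hα, laurentRename_monomial]⟩

/-- A monomial is the product of its parts in the blocks of variables. -/
theorem monomial_eq_prod_rename (u : (Σ i, σ i) →₀ ℕ) :
    monomial u (1 : k) = ∏ i, rename (Sigma.mk i) (monomial (u.split i) (1 : k)) := by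
  simp_rw [rename_monomial]
  rw [← monomial_sum_one]
  refine congrArg (fun v => monomial v (1 : k)) (Finsupp.ext ?_)
  rintro ⟨i, a⟩
  rw [Finsupp.finsetSum_apply, Finset.sum_eq_single i]
  · rw [Finsupp.mapDomain_apply sigma_mk_injective, Finsupp.split_apply]
  · intro j _ hj
    rw [Finsupp.mapDomain_of_notMem_range]
    rintro ⟨b, hb⟩
    exact hj (congrArg Sigma.fst hb)
  · simp

theorem laurentRetract_combinedMap_monomial
    {φ : ∀ i, MvPolynomial (σ i) k →ₐ[k] LaurentRing k (τ i)}
    (h : ∀ i a, ∃ α : τ i →₀ ℤ, φ i (X a) = laurentMonomial k α) (i : Fin r)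
    (u : (Σ i, σ i) →₀ ℕ) :
    laurentRetract k τ i (combinedMap φ (monomial u 1)) = φ i (monomial (u.split i) 1) := by
  rw [monomial_eq_prod_rename, map_prod, map_prod, Finset.prod_eq_single i]
  · rw [combinedMap_rename, laurentRetract_laurentRename_self]
  · intro j _ hj
    obtain ⟨α, hα⟩ := exists_map_monomial_eq_laurentMonomial (h j) (u.split j)
    rw [combinedMap_rename, hα, laurentRetract_laurentRename_of_ne hj]
  · simp

/-- Retracting `φ(x^u) = φ(x^v)` to block `i` puts the difference of the block parts of `x^u` and
`x^v` in `I i`; multiplying these congruences gives `x^u - x^v` in the sum. -/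
theorem ker_combinedMap {I : ∀ i, Ideal (MvPolynomial (σ i) k)}
    {φ : ∀ i, MvPolynomial (σ i) k →ₐ[k] LaurentRing k (τ i)}
    (hφ : ∀ i, IsParametrization (φ i) (I i)) :
    RingHom.ker (combinedMap φ) = sumIdeal I := by
  have hle : ∀ i, (I i).map (rename (Sigma.mk i) :
      MvPolynomial (σ i) k →ₐ[k] MvPolynomial (Σ i, σ i) k) ≤ sumIdeal I := fun i => by
    rw [sumIdeal, Ideal.sum_eq_sup]
    exact Finset.le_sup (f := fun i => (I i).map (rename (Sigma.mk i) :
      MvPolynomial (σ i) k →ₐ[k] MvPolynomial (Σ i, σ i) k)) (Finset.mem_univ i)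
  apply le_antisymm
  · refine ker_le_of_binomials_mem
      (combinedMap_exists_monomial fun i => (hφ i).exists_monomial) _ fun u v huv => ?_
    rw [← Ideal.Quotient.mk_eq_mk_iff_sub_mem, monomial_eq_prod_rename u,
      monomial_eq_prod_rename v, map_prod, map_prod]
    refine Finset.prod_congr rfl fun i _ => ?_
    rw [Ideal.Quotient.mk_eq_mk_iff_sub_mem, ← map_sub]
    refine hle i (Ideal.mem_map_of_mem _ ?_)
    rw [← (hφ i).ker_eq, RingHom.mem_ker, map_sub, sub_eq_zero,
      ← laurentRetract_combinedMap_monomial (fun i => (hφ i).exists_monomial),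
      ← laurentRetract_combinedMap_monomial (fun i => (hφ i).exists_monomial), huv]
  · rw [sumIdeal, Ideal.sum_eq_sup]
    refine Finset.sup_le fun i _ => Ideal.map_le_iff_le_comap.mpr fun p hp => ?_
    rw [← (hφ i).ker_eq, RingHom.mem_ker] at hp
    rw [Ideal.mem_comap, RingHom.mem_ker, combinedMap_rename, hp, map_zero]

/-- An algebraic equation for a variable of block `i` over the image of `φ i` is transported along
the inclusion of Laurent rings. -/
theorem isAlgebraic_range_combinedMap {φ : ∀ i, MvPolynomial (σ i) k →ₐ[k] LaurentRing k (τ i)}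
    (h : ∀ i, Algebra.IsAlgebraic (φ i).range (LaurentRing k (τ i))) :
    Algebra.IsAlgebraic (combinedMap φ).range (LaurentRing k (Σ i, τ i)) := by
  refine laurent_isAlgebraic_of_forall_variable _ ?_
  rintro ⟨i, j⟩
  let f : (φ i).range →ₐ[k] (combinedMap φ).range :=
    ((laurentRename k (Sigma.mk i)).comp (φ i).range.val).codRestrict _ (by
      rintro ⟨_, p, rfl⟩
      exact ⟨rename (Sigma.mk i) p, combinedMap_rename φ i p⟩)
  have hinj : Function.Injective (laurentRename k (Sigma.mk i : τ i → Σ i, τ i)) :=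
    laurentRename_injective sigma_mk_injective
  have hj := ((h i).isAlgebraic (laurentMonomial k (Finsupp.single j 1))).ringHom_of_comp_eq
    f (laurentRename k (Sigma.mk i))
    (fun x y hxy => Subtype.ext (hinj (congrArg Subtype.val hxy))) rfl
  rwa [laurentRename_monomial, Finsupp.mapDomain_single] at hj

theorem isMaximalRankParametrization_combinedMap [∀ i, Finite (σ i)] [∀ i, Finite (τ i)]
    {I : ∀ i, Ideal (MvPolynomial (σ i) k)}
    {φ : ∀ i, MvPolynomial (σ i) k →ₐ[k] LaurentRing k (τ i)}
    (hφ : ∀ i, IsMaximalRankParametrization (φ i) (I i)) :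
    IsMaximalRankParametrization (combinedMap φ) (sumIdeal I) where
  exists_monomial := combinedMap_exists_monomial fun i => (hφ i).exists_monomial
  ker_eq := ker_combinedMap fun i => (hφ i).toIsParametrization
  dim_eq := by
    rw [← ker_combinedMap fun i => (hφ i).toIsParametrization,
      ringKrullDim_quotient_ker_eq_card_iff]
    refine isAlgebraic_range_combinedMap fun i => ?_
    rw [← ringKrullDim_quotient_ker_eq_card_iff, (hφ i).ker_eq, (hφ i).dim_eq]

/-- The retraction to block `i` sends generators of other blocks to `1`, so a redundancy in the
whole family becomes one for `φ i`. -/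
theorem hasMinimalGenerators_combinedMap
    {φ : ∀ i, MvPolynomial (σ i) k →ₐ[k] LaurentRing k (τ i)}
    (h : ∀ i a, ∃ α : τ i →₀ ℤ, φ i (X a) = laurentMonomial k α)
    (hmin : ∀ i, HasMinimalGenerators (φ i)) : HasMinimalGenerators (combinedMap φ) := by
  rintro ⟨i, a⟩ hmem
  refine hmin i a ?_
  have hX (j : Fin r) (b : σ j) :
      combinedMap φ (X ⟨j, b⟩) = laurentRename k (Sigma.mk j) (φ j (X b)) := by
    simp [combinedMap]
  rw [← laurentRetract_laurentRename_self i (φ i (X a)), ← hX]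
  have hle : Algebra.adjoin k ((fun b => combinedMap φ (X b)) '' {⟨i, a⟩}ᶜ) ≤
      (Algebra.adjoin k ((fun b => φ i (X b)) '' {a}ᶜ)).comap (laurentRetract k τ i) := by
    refine Algebra.adjoin_le ?_
    rintro _ ⟨⟨j, b⟩, hb, rfl⟩
    change laurentRetract k τ i (combinedMap φ (X ⟨j, b⟩)) ∈
      Algebra.adjoin k ((fun b => φ i (X b)) '' {a}ᶜ)
    rw [hX]
    by_cases hji : j = i
    · subst hji
      rw [laurentRetract_laurentRename_self]
      refine Algebra.subset_adjoin ⟨b, fun hba => hb ?_, rfl⟩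
      rw [Set.mem_singleton_iff] at hba ⊢
      rw [hba]
    · obtain ⟨α, hα⟩ := h j b
      rw [hα, laurentRetract_laurentRename_of_ne hji]
      exact one_mem _
  exact hle hmem

attribute [local instance] MvPolynomial.gradedAlgebra in
-- Renaming preserves degrees, so homogeneous generators of the `I i` stay homogeneous.
theorem isHomogeneous_sumIdeal {I : ∀ i, Ideal (MvPolynomial (σ i) k)}
    (hI : ∀ i, (I i).IsHomogeneous (homogeneousSubmodule (σ i) k)) :
    (sumIdeal I).IsHomogeneous (homogeneousSubmodule (Σ i, σ i) k) := by
  rw [sumIdeal, Ideal.sum_eq_sup, Finset.sup_eq_iSup]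
  refine Ideal.IsHomogeneous.iSup₂ fun i _ => ?_
  obtain ⟨S, hS⟩ := (Ideal.IsHomogeneous.iff_exists _ _).mp (hI i)
  rw [hS, Ideal.map_span]
  refine Ideal.homogeneous_span _ _ ?_
  rintro _ ⟨_, ⟨⟨p, n, hp⟩, -, rfl⟩, rfl⟩
  exact ⟨n, IsHomogeneous.rename_isHomogeneous hp⟩

end Combined

/-- A parametrization in any finite set of variables witnesses that an ideal is toric. -/
theorem IsParametrization.isToricIdeal {k : Type*} [Field k] {σ τ : Type*} [Finite τ]
    {φ : MvPolynomial σ k →ₐ[k] LaurentRing k τ} {I : Ideal (MvPolynomial σ k)}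
    (h : IsParametrization φ I) : IsToricIdeal I := by
  let e := Finite.equivFin τ
  refine ⟨Nat.card τ, (laurentRename k e).comp φ, fun a => ?_, ?_⟩
  · obtain ⟨α, hα⟩ := h.exists_monomial a
    exact ⟨α.mapDomain e, by rw [AlgHom.comp_apply, hα, laurentRename_monomial]⟩
  · rw [← h.ker_eq]
    ext p
    rw [RingHom.mem_ker, RingHom.mem_ker, AlgHom.comp_apply,
      map_eq_zero_iff _ (laurentRename_injective e.injective)]

theorem mainTheorem3 {k : Type*} [Field k] {r : ℕ} {σ τ : Fin r → Type*}
    [∀ i, Finite (σ i)] [∀ i, Finite (τ i)]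
    (I : ∀ i, Ideal (MvPolynomial (σ i) k))
    (hI : ∀ i, IsHomogeneousToricIdeal (I i))
    (φ : ∀ i, MvPolynomial (σ i) k →ₐ[k] LaurentRing k (τ i))
    (hφ : ∀ i, IsMaximalRankParametrization (φ i) (I i)) :
    IsHomogeneousToricIdeal (sumIdeal I) ∧
      IsMaximalRankParametrization (combinedMap φ) (sumIdeal I) ∧
      ((∀ i, HasMinimalGenerators (φ i)) → HasMinimalGenerators (combinedMap φ)) ∧
      ringKrullDim (MvPolynomial (Σ i, σ i) k ⧸ sumIdeal I) =
        ∑ i, ringKrullDim (MvPolynomial (σ i) k ⧸ I i) := by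
  have hmax := isMaximalRankParametrization_combinedMap hφ
  refine ⟨⟨hmax.toIsParametrization.isToricIdeal, isHomogeneous_sumIdeal fun i => (hI i).2⟩, hmax,
    hasMinimalGenerators_combinedMap fun i => (hφ i).exists_monomial, ?_⟩
  rw [hmax.dim_eq, Nat.card_sigma]
  simp_rw [(hφ _).dim_eq]
  push_cast
  rfl
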